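/- Let $\rho_0$ be a quantum state (a positive semi-definite operator with $\operatorname{Tr}\rho_0=1$) of finite rank on a complex Hilbert space $\mathcal H=\mathcal H_+\oplus\mathcal H_0$, where $\mathcal H_0=\ker\rho_0$ and $\mathcal H_+=\mathcal H_0^{\perp}$ is the support of $\rho_0$; the finite-rank condition holds automatically if $\dim\mathcal H<\infty$. A state perturbation is a Hermitian operator $\nu$ with $\operatorname{Tr}\nu=0$ such that $\rho_0+\nu$ is positive semi-definite; write $$\nu=\begin{pmatrix}\nu_{\rm B}&\nu_{\rm C}\\ \nu_{\rm C}^\dagger&\nu_{\rm D}\end{pmatrix}$$ with respect to $\mathcal H_+\oplus\mathcal H_0$, and let $\|\cdot\|$ be the Hilbert--Schmidt norm. Let $\nu_1,\nu_2$ be state perturbations with $\|\nu_i\|^2/\|\nu_{i,{\rm D}}\|=O(\|\nu_i\|)$ for $i=1,2$ (read as $\|\nu_i\|^2=O(\|\nu_i\|\,\|\nu_{i,{\rm D}}\|)$). Then the fidelity $F(\rho_1,\rho_2)=\Big(\operatorname{Tr}\sqrt{\sqrt{\rho_1}\,\rho_2\sqrt{\rho_1}}\Big)^2$ of the states $\rho_i=\rho_0+\nu_i$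 satisfies, as $\|\nu_1\|,\|\nu_2\|\to0$, $$F(\rho_1,\rho_2)=1+\operatorname{Tr}[\nu_{1,{\rm B}}+\nu_{2,{\rm B}}]+2\operatorname{Tr}\Big[\sqrt{\sqrt{\nu_{1,{\rm D}}}\,\nu_{2,{\rm D}}\sqrt{\nu_{1,{\rm D}}}}\Big]+O\big(\max(\|\nu_1\|,\|\nu_2\|)^{3/2}\big).$$ That is: for every $K$ there are $\delta>0$ and $C$, depending only on $\rho_0$ and $K$, such that the absolute value of the remainder is at most $C\max(\|\nu_1\|,\|\nu_2\|)^{3/2}$ for all state perturbations with $\|\nu_i\|\le\delta$ and $\|\nu_i\|^2\le K\|\nu_i\|\,\|\nu_{i,{\rm D}}\|$, $i=1,2$. -/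

import Mathlib

open scoped InnerProductSpace

noncomputable section

/-- The trace `∑ ⟨bᵢ, T bᵢ⟩` of an operator on a complex Hilbert space with respect to a Hilbert
basis `b`; on trace-class operators (the only ones to which it is applied below) the series
converges absolutely and the value does not depend on `b`. -/
def opTrace {H ι : Type*} [NormedAddCommGroup H] [InnerProductSpace ℂ H]
    (b : HilbertBasis ι ℂ H) (T : H →L[ℂ] H) : ℂ :=
  ∑' i, ⟪b i, T (b i)⟫_ℂ

/-- The Hilbert-Schmidt norm `√(∑ ‖T bᵢ‖²)` of a Hilbert-Schmidt operator (the Frobenius norm if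
the space has finite dimension). -/
def hsNorm {H ι : Type*} [NormedAddCommGroup H] [InnerProductSpace ℂ H]
    (b : HilbertBasis ι ℂ H) (T : H →L[ℂ] H) : ℝ :=
  Real.sqrt (∑' i, ‖T (b i)‖ ^ 2)

/-- Quantum states: positive semi-definite operators of (convergent) trace one. -/
structure IsQuantumState {H ι : Type*} [NormedAddCommGroup H] [InnerProductSpace ℂ H]
    [CompleteSpace H] (b : HilbertBasis ι ℂ H) (ρ : H →L[ℂ] H) : Prop where
  nonneg : 0 ≤ ρ
  hasSum_trace : HasSum (fun i => ⟪b i, ρ (b i)⟫_ℂ) 1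

/-- Perturbations of the state `ρ₀`: Hermitian operators of trace zero for which `ρ₀ + ν` remains
positive semi-definite, so that `ρ₀ + ν` is again a quantum state. -/
structure IsStatePerturbation {H ι : Type*} [NormedAddCommGroup H] [InnerProductSpace ℂ H]
    [CompleteSpace H] (b : HilbertBasis ι ℂ H) (ρ₀ ν : H →L[ℂ] H) : Prop where
  isSelfAdjoint : IsSelfAdjoint ν
  hasSum_trace : HasSum (fun i => ⟪b i, ν (b i)⟫_ℂ) 0
  nonneg : 0 ≤ ρ₀ + ν

/-- The orthogonal projection onto `H₀ = ker ρ₀`. -/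
def kerProj {H : Type*} [NormedAddCommGroup H] [InnerProductSpace ℂ H]
    [CompleteSpace H] (ρ₀ : H →L[ℂ] H) : H →L[ℂ] H :=
  (LinearMap.ker (ρ₀ : H →ₗ[ℂ] H)).starProjection

/-- The orthogonal projection onto the support `H₊ = (ker ρ₀)ᗮ` of `ρ₀`. -/
def suppProj {H : Type*} [NormedAddCommGroup H] [InnerProductSpace ℂ H]
    [CompleteSpace H] (ρ₀ : H →L[ℂ] H) : H →L[ℂ] H :=
  (LinearMap.ker (ρ₀ : H →ₗ[ℂ] H))ᗮ.starProjection

/-- The diagonal block of `ν` on the support `H₊` of `ρ₀`, extended by zero to `H = H₊ ⊕ H₀`. -/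
def blockB {H : Type*} [NormedAddCommGroup H] [InnerProductSpace ℂ H]
    [CompleteSpace H] (ρ₀ ν : H →L[ℂ] H) : H →L[ℂ] H :=
  suppProj ρ₀ * ν * suppProj ρ₀

/-- The diagonal block of `ν` on the kernel `H₀` of `ρ₀`, extended by zero to `H = H₊ ⊕ H₀`. -/
def blockD {H : Type*} [NormedAddCommGroup H] [InnerProductSpace ℂ H]
    [CompleteSpace H] (ρ₀ ν : H →L[ℂ] H) : H →L[ℂ] H :=
  kerProj ρ₀ * ν * kerProj ρ₀

/-- `Tr √(√S T √S)` for positive semi-definite trace-class operators `S` and `T`. -/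
def rootFidelity {H ι : Type*} [NormedAddCommGroup H] [InnerProductSpace ℂ H]
    [CompleteSpace H] (b : HilbertBasis ι ℂ H) (S T : H →L[ℂ] H) : ℝ :=
  (opTrace b (CFC.sqrt (CFC.sqrt S * T * CFC.sqrt S))).re

/-- The quantum fidelity `(Tr √(√ρ₁ ρ₂ √ρ₁))²`. -/
def fidelity {H ι : Type*} [NormedAddCommGroup H] [InnerProductSpace ℂ H]
    [CompleteSpace H] (b : HilbertBasis ι ℂ H) (ρ₁ ρ₂ : H →L[ℂ] H) : ℝ :=
  rootFidelity b ρ₁ ρ₂ ^ 2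

end

/-! Write `ρᵢ = yᵢ²` with `yᵢ = √ρᵢ`. By Uhlmann's theorem (`hsInner_le_rootFidelity`,
`exists_rootFidelity_eq_hsInner`) the root fidelity is the maximum of `Re ⟪y₁, y₂ W⟫` over
contractions `W`, in the Hilbert-Schmidt pairing. Let `P`, `Q` be the projections onto support and
kernel of `ρ₀`.

Upper bound (`rootFidelity_le_add`): the pairing splits along `P + Q = 1`. The `P` part is at most
the mean of the traces `‖P yᵢ‖²`, the `Q` part at most the root fidelity of the D blocks.

Lower bound (`IsCompressedInverse.le_rootFidelity`): let `gᵢ` invert `P ρᵢ P` on the support, so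
that `Eᵢ = yᵢ gᵢ yᵢ` projects onto the range of `yᵢ P`. For `U` optimal for the D blocks, `½ y₂ (g₁
+ g₂) y₁ + (1 - E₂) U (1 - E₁)` has norm at most `1 + O(ε²)` by `norm_glue_le`, with `ε = max ‖νᵢ‖`,
and nearly attains the upper bound. The loss is governed by `ε η`, where the off-diagonal blocks are
at most `ε` and `‖Q yᵢ‖ ≤ η`. Since `‖Q yᵢ‖² = 1 - ‖P yᵢ‖² = O(ε)` (`one_sub_le_of_perturbation`),
`η = O(√ε)` and the loss is `O(ε^{3/2})`. Squaring (`abs_sq_sub_le`) costs only `O(ε²)` more. -/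

/-! ### Hilbert-Schmidt operators and their real inner product -/

section HilbertSchmidt

variable {H ι : Type*} [NormedAddCommGroup H] [InnerProductSpace ℂ H]

/-- The Hilbert-Schmidt operators: `∑ ‖T bᵢ‖²` converges. -/
def IsHS (b : HilbertBasis ι ℂ H) (T : H →L[ℂ] H) : Prop :=
  Summable fun i => ‖T (b i)‖ ^ 2

/-- The real part of the Hilbert-Schmidt inner product. -/
noncomputable def hsInner (b : HilbertBasis ι ℂ H) (S T : H →L[ℂ] H) : ℝ :=
  ∑' i, (⟪S (b i), T (b i)⟫_ℂ).re

variable {b : HilbertBasis ι ℂ H} {S T R : H →L[ℂ] H}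

/-- The square-summable family of values of a Hilbert-Schmidt operator on the basis. -/
noncomputable def IsHS.toLp (hT : IsHS b T) : lp (fun _ : ι => H) 2 :=
  ⟨fun i => T (b i), memℓp_gen (by simpa [IsHS] using hT)⟩

lemma IsHS.of_memlp (h : Memℓp (fun i => T (b i)) 2) : IsHS b T := by
  simpa [IsHS] using h.summable (by norm_num)

lemma IsHS.add (hS : IsHS b S) (hT : IsHS b T) : IsHS b (S + T) :=
  .of_memlp (hS.toLp + hT.toLp).2

lemma IsHS.sub (hS : IsHS b S) (hT : IsHS b T) : IsHS b (S - T) :=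
  .of_memlp (hS.toLp - hT.toLp).2

lemma IsHS.norm_toLp (hT : IsHS b T) : ‖hT.toLp‖ = hsNorm b T := by
  rw [lp.norm_eq_tsum_rpow (by norm_num), hsNorm, Real.sqrt_eq_rpow]
  simp [IsHS.toLp]

lemma IsHS.hasSum_hsInner (hS : IsHS b S) (hT : IsHS b T) :
    HasSum (fun i => (⟪S (b i), T (b i)⟫_ℂ).re) (hsInner b S T) :=
  ((Complex.hasSum_re (lp.hasSum_inner (𝕜 := ℂ) hS.toLp hT.toLp)).summable).hasSum

lemma IsHS.hsInner_eq (hS : IsHS b S) (hT : IsHS b T) :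
    hsInner b S T = (⟪hS.toLp, hT.toLp⟫_ℂ).re :=
  (hS.hasSum_hsInner hT).unique (Complex.hasSum_re (lp.hasSum_inner (𝕜 := ℂ) hS.toLp hT.toLp))

lemma hsNorm_nonneg : 0 ≤ hsNorm b T := Real.sqrt_nonneg _

lemma hsNorm_sq : hsNorm b T ^ 2 = ∑' i, ‖T (b i)‖ ^ 2 :=
  Real.sq_sqrt (tsum_nonneg fun _ => by positivity)

lemma hsInner_self : hsInner b T T = hsNorm b T ^ 2 := by
  rw [hsNorm_sq]
  exact tsum_congr fun _ => inner_self_eq_norm_sq (𝕜 := ℂ) _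

lemma hsInner_comm : hsInner b S T = hsInner b T S :=
  tsum_congr fun _ => inner_re_symm (𝕜 := ℂ) _ _

lemma IsHS.abs_hsInner_le (hS : IsHS b S) (hT : IsHS b T) :
    |hsInner b S T| ≤ hsNorm b S * hsNorm b T := by
  rw [hS.hsInner_eq hT, ← hS.norm_toLp, ← hT.norm_toLp]
  exact (Complex.abs_re_le_norm _).trans (norm_inner_le_norm _ _)

lemma IsHS.hsInner_add_right (hR : IsHS b R) (hS : IsHS b S) (hT : IsHS b T) :
    hsInner b R (S + T) = hsInner b R S + hsInner b R T := by
  refine (((hR.hasSum_hsInner hS).add (hR.hasSum_hsInner hT)).congr_fun ?_).tsum_eq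
  intro _
  simp

lemma IsHS.hsInner_sub_right (hR : IsHS b R) (hS : IsHS b S) (hT : IsHS b T) :
    hsInner b R (S - T) = hsInner b R S - hsInner b R T := by
  have := hR.hsInner_add_right (hS.sub hT) hT
  rw [sub_add_cancel] at this
  linarith

lemma IsHS.hsInner_sub_left (hR : IsHS b R) (hS : IsHS b S) (hT : IsHS b T) :
    hsInner b (S - T) R = hsInner b S R - hsInner b T R := by
  rw [hsInner_comm, hR.hsInner_sub_right hS hT, hsInner_comm, hsInner_comm (S := R)]

lemma hsInner_smul_right (c : ℝ) : hsInner b S ((c : ℂ) • T) = c * hsInner b S T := by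
  simp only [hsInner, ← tsum_mul_left]
  exact tsum_congr fun i => by simp

lemma hsInner_two_mul_right {S T : H →L[ℂ] H} : hsInner b S (2 * T) = 2 * hsInner b S T := by
  rw [← hsInner_smul_right, two_mul, ← two_smul ℂ T]
  norm_cast

/-- Lets the invariance of the norm under adjoints pass to the pairing. -/
lemma IsHS.hsInner_polarization (hS : IsHS b S) (hT : IsHS b T) :
    hsInner b S T = (hsNorm b (S + T) ^ 2 - hsNorm b (S - T) ^ 2) / 4 := by
  have h1 := (hS.add hT).hsInner_add_right hS hT
  have h2 := (hS.sub hT).hsInner_sub_right hS hT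
  rw [hsInner_comm (T := S), hsInner_comm (T := T), hS.hsInner_add_right hS hT,
    hT.hsInner_add_right hS hT, hsInner_self] at h1
  rw [hsInner_comm (T := S), hsInner_comm (T := T), hS.hsInner_sub_right hS hT,
    hT.hsInner_sub_right hS hT, hsInner_self] at h2
  rw [h1, h2, hsInner_comm (S := T) (T := S)]
  ring

lemma IsHS.mul_left (A : H →L[ℂ] H) (hT : IsHS b T) : IsHS b (A * T) := by
  refine Summable.of_nonneg_of_le (fun _ => by positivity) (fun i => ?_)
    (Summable.mul_left (‖A‖ ^ 2) hT)
  rw [← mul_pow]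
  gcongr
  exact A.le_opNorm _

lemma IsHS.hsNorm_mul_left_le (A : H →L[ℂ] H) (hT : IsHS b T) :
    hsNorm b (A * T) ≤ ‖A‖ * hsNorm b T := by
  refine Real.sqrt_le_iff.2 ⟨by have := hsNorm_nonneg (b := b) (T := T); positivity, ?_⟩
  rw [mul_pow, hsNorm_sq, ← tsum_mul_left]
  refine (hT.mul_left A).tsum_le_tsum (fun i => ?_) (Summable.mul_left _ hT)
  rw [← mul_pow]
  gcongr
  exact A.le_opNorm _

/-- Parseval with values in `ENNReal`, where double sums may be exchanged before summability is
known. -/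
lemma HilbertBasis.tsum_enorm_inner_sq (b : HilbertBasis ι ℂ H) (v : H) :
    ∑' i, ENNReal.ofReal (‖⟪b i, v⟫_ℂ‖ ^ 2) = ENNReal.ofReal (‖v‖ ^ 2) := by
  have h : HasSum (fun i => ‖⟪b i, v⟫_ℂ‖ ^ 2) (‖v‖ ^ 2) := by
    have := Complex.hasSum_re (b.hasSum_inner_mul_inner v v)
    rw [show (⟪v, v⟫_ℂ).re = ‖v‖ ^ 2 from inner_self_eq_norm_sq (𝕜 := ℂ) v] at this
    refine this.congr_fun fun i => ?_
    rw [← inner_conj_symm v, Complex.conj_mul']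
    norm_cast
  rw [← h.tsum_eq, ENNReal.ofReal_tsum_of_nonneg (fun _ => by positivity) h.summable]

lemma isHS_iff_tsum_ne_top :
    IsHS b T ↔ ∑' i, ENNReal.ofReal (‖T (b i)‖ ^ 2) ≠ ⊤ := by
  refine ⟨fun h => ?_, fun h => ?_⟩
  · rw [← ENNReal.ofReal_tsum_of_nonneg (fun _ => by positivity) h]
    exact ENNReal.ofReal_ne_top
  · refine (ENNReal.summable_toReal h).congr fun i => ?_
    rw [ENNReal.toReal_ofReal (by positivity)]

variable [CompleteSpace H]

lemma inner_star_apply (A : H →L[ℂ] H) (u v : H) : ⟪u, star A v⟫_ℂ = ⟪A u, v⟫_ℂ :=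
  A.adjoint_inner_right u v

lemma hsInner_mul_left (A : H →L[ℂ] H) : hsInner b (A * S) T = hsInner b S (star A * T) :=
  tsum_congr fun i => congrArg Complex.re (inner_star_apply A (S (b i)) (T (b i))).symm

/-- By Parseval both sides are the double sum of the squared matrix entries, and Tonelli exchanges
the order. -/
lemma tsum_enorm_star_sq (b : HilbertBasis ι ℂ H) (T : H →L[ℂ] H) :
    ∑' i, ENNReal.ofReal (‖star T (b i)‖ ^ 2) = ∑' i, ENNReal.ofReal (‖T (b i)‖ ^ 2) := by
  simp_rw [← b.tsum_enorm_inner_sq]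
  rw [ENNReal.tsum_comm]
  refine tsum_congr fun i => tsum_congr fun j => ?_
  rw [inner_star_apply, norm_inner_symm]

lemma IsHS.star (hT : IsHS b T) : IsHS b (star T) := by
  rw [isHS_iff_tsum_ne_top, tsum_enorm_star_sq]
  exact isHS_iff_tsum_ne_top.1 hT

lemma IsHS.hsNorm_star (hT : IsHS b T) : hsNorm b (Star.star T) = hsNorm b T := by
  have h := tsum_enorm_star_sq b T
  rw [← ENNReal.ofReal_tsum_of_nonneg (fun _ => by positivity) hT,
    ← ENNReal.ofReal_tsum_of_nonneg (fun _ => by positivity) hT.star,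
    ENNReal.ofReal_eq_ofReal_iff (tsum_nonneg fun _ => by positivity)
      (tsum_nonneg fun _ => by positivity)] at h
  rw [hsNorm, hsNorm, h]

lemma IsHS.hsInner_star (hS : IsHS b S) (hT : IsHS b T) :
    hsInner b (Star.star S) (Star.star T) = hsInner b S T := by
  rw [hS.hsInner_polarization hT, hS.star.hsInner_polarization hT.star, ← star_add, ← star_sub,
    (hS.add hT).hsNorm_star, (hS.sub hT).hsNorm_star]

lemma IsHS.mul_right (hT : IsHS b T) (A : H →L[ℂ] H) : IsHS b (T * A) := by
  simpa using (hT.star.mul_left (Star.star A)).star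

lemma IsHS.hsNorm_mul_right_le (hT : IsHS b T) (A : H →L[ℂ] H) :
    hsNorm b (T * A) ≤ hsNorm b T * ‖A‖ := by
  rw [← (hT.mul_right A).hsNorm_star, star_mul, mul_comm, ← hT.hsNorm_star, ← norm_star A]
  exact hT.star.hsNorm_mul_left_le _

/-- Cyclicity of the trace: passing to adjoints turns right factors into left ones, which move
across termwise. -/
lemma IsHS.hsInner_mul_right (hS : IsHS b S) (hT : IsHS b T) (A : H →L[ℂ] H) :
    hsInner b (S * A) T = hsInner b S (T * Star.star A) := by
  rw [← (hS.mul_right A).hsInner_star hT, star_mul, hsInner_mul_left, star_star,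
    ← hS.hsInner_star (hT.mul_right _), star_mul, star_star]

lemma IsHS.norm_le_hsNorm (hT : IsHS b T) : ‖T‖ ≤ hsNorm b T := by
  rw [← norm_star T]
  refine ContinuousLinearMap.opNorm_le_bound _ hsNorm_nonneg fun v => ?_
  have h0 : 0 ≤ hsNorm b T * ‖v‖ := mul_nonneg hsNorm_nonneg (norm_nonneg _)
  rw [← Real.sqrt_sq h0]
  refine Real.le_sqrt_of_sq_le ?_
  rw [← ENNReal.ofReal_le_ofReal_iff (by positivity), ← b.tsum_enorm_inner_sq, mul_pow, hsNorm_sq,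
    ← tsum_mul_right, ENNReal.ofReal_tsum_of_nonneg (fun _ => by positivity)
      (Summable.mul_right _ hT)]
  refine ENNReal.tsum_le_tsum fun i => ENNReal.ofReal_le_ofReal ?_
  rw [inner_star_apply, ← mul_pow]
  gcongr
  exact norm_inner_le_norm _ _

end HilbertSchmidt

/-! ### Polar decomposition and Uhlmann's theorem -/

section Uhlmann

variable {H ι : Type*} [NormedAddCommGroup H] [InnerProductSpace ℂ H] [CompleteSpace H]

/-- Douglas' factorization lemma. -/
lemma exists_contraction_mul_eq {A B : H →L[ℂ] H} (h : ∀ v, ‖A v‖ ≤ ‖B v‖) :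
    ∃ W : H →L[ℂ] H, ‖W‖ ≤ 1 ∧ A = W * B := by
  set K := (LinearMap.range (B : H →ₗ[ℂ] H)).topologicalClosure
  have hBK : ∀ v, (B : H →ₗ[ℂ] H) v ∈ K := fun v =>
    Submodule.le_topologicalClosure _ (LinearMap.mem_range_self _ v)
  let e : H →ₗ[ℂ] K := (B : H →ₗ[ℂ] H).codRestrict K hBK
  have hd : DenseRange e := by
    intro x
    rw [closure_subtype]
    have hx : (x : H) ∈ closure (LinearMap.range (B : H →ₗ[ℂ] H) : Set H) := x.2
    refine closure_mono ?_ hx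
    rintro _ ⟨v, rfl⟩
    exact ⟨e v, ⟨v, rfl⟩, rfl⟩
  have hn : ∀ v, ‖(A : H →ₗ[ℂ] H) v‖ ≤ 1 * ‖e v‖ := fun v => by simpa [e] using h v
  have : CompleteSpace K := (Submodule.isClosed_topologicalClosure _).completeSpace_coe
  -- `B v ↦ A v` is well defined and contractive on the range of `B`; it extends continuously to the
  -- closure and by zero to the complement.
  let V := (A : H →ₗ[ℂ] H).extendOfNorm e
  refine ⟨V.comp K.orthogonalProjectionOnto, ?_, ?_⟩
  · refine (ContinuousLinearMap.opNorm_comp_le _ _).trans ?_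
    exact mul_le_one₀ (LinearMap.opNorm_extendOfNorm_le hd zero_le_one hn) (norm_nonneg _)
      K.orthogonalProjectionOnto_norm_le
  · ext v
    have h1 : K.orthogonalProjectionOnto (B v) = e v :=
      Submodule.orthogonalProjectionOnto_mem_subspace_eq_self (K := K) (e v)
    change A v = V (K.orthogonalProjectionOnto (B v))
    rw [h1]
    exact (LinearMap.extendOfNorm_eq hd ⟨1, hn⟩ v).symm

lemma norm_apply_eq_of_star_mul_self_eq {A B : H →L[ℂ] H} (h : star A * A = star B * B) (v : H) :
    ‖A v‖ = ‖B v‖ := by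
  have := congrArg (fun T : H →L[ℂ] H => ⟪v, T v⟫_ℂ) h
  simp only [ContinuousLinearMap.star_eq_adjoint, mul_apply_eq_comp,
    ContinuousLinearMap.adjoint_inner_right, inner_self_eq_norm_sq_to_K] at this
  have h2 : ‖A v‖ ^ 2 = ‖B v‖ ^ 2 := by exact_mod_cast this
  exact (sq_eq_sq₀ (norm_nonneg _) (norm_nonneg _)).1 h2

/-- If `A` and `B` have the same absolute value, contractions map each to the other. -/
lemma exists_contraction_of_star_mul_self_eq {A B : H →L[ℂ] H} (h : star A * A = star B * B) :
    ∃ W : H →L[ℂ] H, ‖W‖ ≤ 1 ∧ A = W * B ∧ B = star W * A := by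
  have hAB := norm_apply_eq_of_star_mul_self_eq h
  obtain ⟨W, hW, hA⟩ := exists_contraction_mul_eq fun v => (hAB v).le
  refine ⟨W, hW, hA, ?_⟩
  ext v
  have h1 : ‖star W (A v)‖ ≤ ‖B v‖ := by
    rw [← hAB]
    exact (ContinuousLinearMap.le_of_opNorm_le _ (by rwa [norm_star]) _).trans (one_mul _).le
  have h2 : (⟪star W (A v), B v⟫_ℂ).re = ‖B v‖ ^ 2 := by
    rw [ContinuousLinearMap.star_eq_adjoint, ContinuousLinearMap.adjoint_inner_left,
      show W (B v) = A v by rw [hA]; rfl, ← hAB]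
    exact inner_self_eq_norm_sq (𝕜 := ℂ) _
  -- Equality case of Cauchy-Schwarz: a vector no longer than `B v` whose real pairing with it is
  -- `‖B v‖²` must be `B v`.
  have h3 : ‖star W (A v) - B v‖ ^ 2 ≤ 0 := by
    have h4 : (‖star W (A v) - B v‖ : ℝ) ^ 2
        = ‖star W (A v)‖ ^ 2 - 2 * (⟪star W (A v), B v⟫_ℂ).re + ‖B v‖ ^ 2 :=
      norm_sub_sq (𝕜 := ℂ) _ _
    rw [h4, h2]
    have := pow_le_pow_left₀ (norm_nonneg _) h1 2
    linarith
  have h5 : star W (A v) - B v = 0 := by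
    rw [← norm_eq_zero]
    exact pow_eq_zero_iff two_ne_zero |>.1 (le_antisymm h3 (by positivity))
  exact (sub_eq_zero.1 h5).symm

lemma star_sqrt (S : H →L[ℂ] H) : star (CFC.sqrt S) = CFC.sqrt S :=
  (IsSelfAdjoint.of_nonneg (CFC.sqrt_nonneg S)).star_eq

lemma re_inner_apply_eq_norm_sqrt_sq {m : H →L[ℂ] H} (hm : 0 ≤ m) (v : H) :
    (⟪v, m v⟫_ℂ).re = ‖CFC.sqrt m v‖ ^ 2 := by
  have h : m v = star (CFC.sqrt m) (CFC.sqrt m v) := by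
    rw [star_sqrt, ← mul_apply_eq_comp, CFC.sqrt_mul_sqrt_self _ hm]
  rw [h, inner_star_apply]
  exact inner_self_eq_norm_sq (𝕜 := ℂ) _

variable {b : HilbertBasis ι ℂ H} {S T Y Z : H →L[ℂ] H}

lemma IsHS.of_star_mul_self_eq (hY : IsHS b Y) (h : Star.star S * S = Star.star Y * Y) :
    IsHS b S :=
  Summable.congr hY fun i => by rw [norm_apply_eq_of_star_mul_self_eq h]

lemma isHS_sqrt (hY : IsHS b Y) : IsHS b (CFC.sqrt (Y * star Y)) := by
  refine hY.star.of_star_mul_self_eq ?_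
  rw [star_sqrt, star_star, CFC.sqrt_mul_sqrt_self _ (mul_star_self_nonneg Y)]

/-- The root fidelity is nonnegative, is attained by a contraction, and bounds all competitors,
for the square-root factors. -/
lemma rootFidelity_sqrt (hT : 0 ≤ T) (hs : IsHS b (CFC.sqrt S)) (ht : IsHS b (CFC.sqrt T)) :
    0 ≤ rootFidelity b S T ∧
    (∃ W : H →L[ℂ] H, ‖W‖ ≤ 1 ∧
      rootFidelity b S T = hsInner b (CFC.sqrt S) (CFC.sqrt T * W)) ∧
    ∀ V : H →L[ℂ] H,
      hsInner b (CFC.sqrt S) (CFC.sqrt T * V) ≤ ‖V‖ * rootFidelity b S T := by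
  set s := CFC.sqrt S with hsdef
  set t := CFC.sqrt T with htdef
  have hss : star s = s := star_sqrt S
  have hts : star t = t := star_sqrt T
  have htt : t * t = T := CFC.sqrt_mul_sqrt_self _ hT
  have hX : star (t * s) * (t * s) = s * T * s := by
    rw [star_mul, hss, hts, ← htt]; noncomm_ring
  have hsTs : 0 ≤ s * T * s := hX ▸ star_mul_self_nonneg (t * s)
  set m := CFC.sqrt (s * T * s) with hm
  have hm0 : 0 ≤ m := CFC.sqrt_nonneg _
  have hms : star m = m := star_sqrt _
  obtain ⟨W, hW, hXW, hmW⟩ := exists_contraction_of_star_mul_self_eq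
    (A := t * s) (B := m) (by rw [hX, hms, CFC.sqrt_mul_sqrt_self _ hsTs])
  -- The trace of `m = |t s|` becomes the squared Hilbert-Schmidt norm of its root `h`.
  set h := CFC.sqrt m with hh
  have hhs : star h = h := star_sqrt m
  have hhh : h * h = m := CFC.sqrt_mul_sqrt_self _ hm0
  have hinner : ∀ i, ⟪b i, m (b i)⟫_ℂ = ⟪(t * W) (b i), s (b i)⟫_ℂ := fun i => by
    have h1 : m (b i) = star (t * W) (s (b i)) := by
      rw [star_mul, hts, ← mul_apply_eq_comp, mul_assoc, ← hmW]
    rw [h1, inner_star_apply]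
  have hinner' : ∀ i, ‖h (b i)‖ ^ 2 = (⟪b i, m (b i)⟫_ℂ).re := fun i =>
    (re_inner_apply_eq_norm_sqrt_sq hm0 (b i)).symm
  have hsum : HasSum (fun i => ⟪b i, m (b i)⟫_ℂ) ⟪(ht.mul_right W).toLp, hs.toLp⟫_ℂ :=
    (lp.hasSum_inner (𝕜 := ℂ) (ht.mul_right W).toLp hs.toLp).congr_fun hinner
  have hre := Complex.hasSum_re hsum
  have hF : rootFidelity b S T = (⟪(ht.mul_right W).toLp, hs.toLp⟫_ℂ).re :=
    congrArg Complex.re hsum.tsum_eq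
  have hhHS : IsHS b h := hre.summable.congr fun i => (hinner' i).symm
  have hF' : rootFidelity b S T = hsNorm b h ^ 2 := by
    rw [hF, hsNorm_sq, ← hre.tsum_eq]
    exact tsum_congr fun i => (hinner' i).symm
  refine ⟨hF' ▸ sq_nonneg _, ⟨W, hW, ?_⟩, fun V => ?_⟩
  · rw [hF, ← (ht.mul_right W).hsInner_eq hs, hsInner_comm]
  -- Only left factors are moved here, which is valid termwise although `V` need not be
  -- Hilbert-Schmidt.
  · have h1 : hsInner b s (t * V) = hsInner b h (h * (star W * V)) := by
      nth_rw 1 [← hts]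
      rw [← hsInner_mul_left, hXW, hsInner_mul_left, ← hhh, hsInner_mul_left, hhs]
    rw [h1, hF']
    have h2 : ‖star W * V‖ ≤ ‖V‖ := by
      refine (norm_mul_le _ _).trans ?_
      rw [norm_star]
      exact mul_le_of_le_one_left (norm_nonneg _) hW
    calc _ ≤ hsNorm b h * hsNorm b (h * (star W * V)) :=
          (le_abs_self _).trans (hhHS.abs_hsInner_le (hhHS.mul_right _))
      _ ≤ hsNorm b h * (hsNorm b h * ‖V‖) := by
          gcongr
          · exact hsNorm_nonneg
          · refine (hhHS.hsNorm_mul_right_le _).trans ?_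
            gcongr
            exact hsNorm_nonneg
      _ = ‖V‖ * hsNorm b h ^ 2 := by ring

/-- Polar decomposition of `star Y`: the positive root of `Y * star Y` and `Y` differ by
contractions on the right, so any factor may replace the root in Uhlmann's theorem. -/
lemma exists_contraction_sqrt_mul_star (Y : H →L[ℂ] H) :
    ∃ V : H →L[ℂ] H, ‖V‖ ≤ 1 ∧ CFC.sqrt (Y * star Y) = Y * V ∧
      Y = CFC.sqrt (Y * star Y) * star V := by
  obtain ⟨V, hV, h1, h2⟩ := exists_contraction_of_star_mul_self_eq
    (A := CFC.sqrt (Y * star Y)) (B := star Y)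
    (by rw [star_sqrt, star_star, CFC.sqrt_mul_sqrt_self _ (mul_star_self_nonneg Y)])
  refine ⟨star V, by rwa [norm_star], ?_, ?_⟩
  · simpa [star_sqrt] using congrArg star h1
  · simpa [star_sqrt] using congrArg star h2

/-- One half of Uhlmann's theorem: overlaps of purifications are bounded by the root fidelity. -/
lemma hsInner_le_rootFidelity (hY : IsHS b Y) (hZ : IsHS b Z) (W : H →L[ℂ] H) :
    hsInner b Y (Z * W) ≤ ‖W‖ * rootFidelity b (Y * star Y) (Z * star Z) := by
  obtain ⟨V, hV, -, hYV⟩ := exists_contraction_sqrt_mul_star Y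
  obtain ⟨V', hV', -, hZV⟩ := exists_contraction_sqrt_mul_star Z
  have hsY := isHS_sqrt hY
  have hsZ := isHS_sqrt hZ
  obtain ⟨h0, -, hle⟩ := rootFidelity_sqrt (mul_star_self_nonneg Z) hsY hsZ
  calc hsInner b Y (Z * W)
      = hsInner b (CFC.sqrt (Y * star Y)) (CFC.sqrt (Z * star Z) * (star V' * W * V)) := by
        nth_rw 1 [hYV, hZV]
        rw [hsY.hsInner_mul_right ((hsZ.mul_right _).mul_right _), star_star]
        simp only [mul_assoc]
    _ ≤ ‖star V' * W * V‖ * rootFidelity b (Y * star Y) (Z * star Z) := hle _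
    _ ≤ ‖W‖ * rootFidelity b (Y * star Y) (Z * star Z) := by
        gcongr
        calc ‖star V' * W * V‖ ≤ ‖star V'‖ * ‖W‖ * ‖V‖ := norm_mul₃_le
          _ ≤ 1 * ‖W‖ * 1 := by gcongr; rwa [norm_star]
          _ = ‖W‖ := by ring

/-- The other half of Uhlmann's theorem: the root fidelity is the overlap of two purifications. -/
lemma exists_rootFidelity_eq_hsInner (hY : IsHS b Y) (hZ : IsHS b Z) :
    ∃ W : H →L[ℂ] H, ‖W‖ ≤ 1 ∧
      rootFidelity b (Y * star Y) (Z * star Z) = hsInner b Y (Z * W) := by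
  obtain ⟨V, hV, hYV, -⟩ := exists_contraction_sqrt_mul_star Y
  obtain ⟨V', hV', hZV, -⟩ := exists_contraction_sqrt_mul_star Z
  obtain ⟨-, ⟨W₀, hW₀, hF⟩, -⟩ :=
    rootFidelity_sqrt (mul_star_self_nonneg Z) (isHS_sqrt hY) (isHS_sqrt hZ)
  refine ⟨V' * W₀ * star V, ?_, ?_⟩
  · calc ‖V' * W₀ * star V‖ ≤ ‖V'‖ * ‖W₀‖ * ‖star V‖ := norm_mul₃_le
      _ ≤ 1 * 1 * 1 := by gcongr; rwa [norm_star]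
      _ = 1 := by ring
  · rw [hF, hYV, hZV, hY.hsInner_mul_right ((hZ.mul_right _).mul_right _)]
    simp only [mul_assoc]

lemma rootFidelity_nonneg (hY : IsHS b Y) (hZ : IsHS b Z) :
    0 ≤ rootFidelity b (Y * star Y) (Z * star Z) := 
  (rootFidelity_sqrt (mul_star_self_nonneg Z) (isHS_sqrt hY) (isHS_sqrt hZ)).1

lemma rootFidelity_le (hY : IsHS b Y) (hZ : IsHS b Z) :
    rootFidelity b (Y * star Y) (Z * star Z) ≤ hsNorm b Y * hsNorm b Z := by
  obtain ⟨W, hW, h⟩ := exists_rootFidelity_eq_hsInner hY hZ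
  rw [h]
  refine (le_abs_self _).trans ((hY.abs_hsInner_le (hZ.mul_right W)).trans ?_)
  gcongr
  · exact hsNorm_nonneg
  · exact (hZ.hsNorm_mul_right_le W).trans (mul_le_of_le_one_right hsNorm_nonneg hW)

end Uhlmann

/-! ### Inverting the compression to the support -/

section CompressedInverse

variable {H : Type*} [NormedAddCommGroup H] [InnerProductSpace ℂ H] [CompleteSpace H]

lemma suppProj_add_kerProj (ρ₀ : H →L[ℂ] H) : suppProj ρ₀ + kerProj ρ₀ = 1 := by
  rw [add_comm]
  exact (Submodule.id_eq_sum_starProjection_self_orthogonalComplement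
    (K := LinearMap.ker (ρ₀ : H →ₗ[ℂ] H))).symm

lemma star_suppProj (ρ₀ : H →L[ℂ] H) : star (suppProj ρ₀) = suppProj ρ₀ :=
  (isSelfAdjoint_starProjection _).star_eq

lemma star_kerProj (ρ₀ : H →L[ℂ] H) : star (kerProj ρ₀) = kerProj ρ₀ :=
  (isSelfAdjoint_starProjection _).star_eq

lemma suppProj_mul_self (ρ₀ : H →L[ℂ] H) : suppProj ρ₀ * suppProj ρ₀ = suppProj ρ₀ :=
  Submodule.isIdempotentElem_starProjection _

lemma suppProj_mul_kerProj (ρ₀ : H →L[ℂ] H) : suppProj ρ₀ * kerProj ρ₀ = 0 := by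
  rw [← sub_eq_of_eq_add' (suppProj_add_kerProj ρ₀).symm, mul_sub, mul_one, suppProj_mul_self,
    sub_self]

lemma kerProj_mul_suppProj (ρ₀ : H →L[ℂ] H) : kerProj ρ₀ * suppProj ρ₀ = 0 := by
  rw [← sub_eq_of_eq_add' (suppProj_add_kerProj ρ₀).symm, sub_mul, one_mul, suppProj_mul_self,
    sub_self]

lemma mul_kerProj (ρ₀ : H →L[ℂ] H) : ρ₀ * kerProj ρ₀ = 0 := by
  ext v
  exact Submodule.starProjection_apply_mem (LinearMap.ker (ρ₀ : H →ₗ[ℂ] H)) v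

lemma mul_suppProj (ρ₀ : H →L[ℂ] H) : ρ₀ * suppProj ρ₀ = ρ₀ := by
  rw [← sub_eq_of_eq_add (suppProj_add_kerProj ρ₀).symm, mul_sub, mul_kerProj, mul_one, sub_zero]

lemma suppProj_mul {ρ₀ : H →L[ℂ] H} (h : IsSelfAdjoint ρ₀) : suppProj ρ₀ * ρ₀ = ρ₀ := by
  simpa [h.star_eq, star_suppProj] using congrArg star (mul_suppProj ρ₀)

lemma kerProj_mul {ρ₀ : H →L[ℂ] H} (h : IsSelfAdjoint ρ₀) : kerProj ρ₀ * ρ₀ = 0 := by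
  simpa [h.star_eq, star_kerProj] using congrArg star (mul_kerProj ρ₀)

lemma norm_suppProj_le (ρ₀ : H →L[ℂ] H) : ‖suppProj ρ₀‖ ≤ 1 :=
  Submodule.starProjection_norm_le _

lemma norm_kerProj_le (ρ₀ : H →L[ℂ] H) : ‖kerProj ρ₀‖ ≤ 1 :=
  Submodule.starProjection_norm_le _

/-- A self-adjoint operator of finite rank becomes invertible after adding the projection onto
its kernel. -/
lemma isUnit_add_kerProj {ρ₀ : H →L[ℂ] H} (h : IsSelfAdjoint ρ₀)
    (hrank : FiniteDimensional ℂ (LinearMap.range (ρ₀ : H →ₗ[ℂ] H))) :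
    IsUnit (ρ₀ + kerProj ρ₀) := by
  rw [ContinuousLinearMap.isUnit_iff_bijective]
  have hQ : ∀ v, kerProj ρ₀ (ρ₀ v) = 0 := fun v => DFunLike.congr_fun (kerProj_mul h) v
  have hP : ∀ v, ρ₀ (suppProj ρ₀ v) = ρ₀ v := fun v => DFunLike.congr_fun (mul_suppProj ρ₀) v
  have hρQ : ∀ v, ρ₀ (kerProj ρ₀ v) = 0 := fun v => DFunLike.congr_fun (mul_kerProj ρ₀) v
  have hQP : ∀ v, kerProj ρ₀ (suppProj ρ₀ v) = 0 := fun v =>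
    DFunLike.congr_fun (kerProj_mul_suppProj ρ₀) v
  have hPQ : ∀ v, suppProj ρ₀ v + kerProj ρ₀ v = v := fun v =>
    DFunLike.congr_fun (suppProj_add_kerProj ρ₀) v
  have hQQ : ∀ v, kerProj ρ₀ (kerProj ρ₀ v) = kerProj ρ₀ v := fun v => by
    have := congrArg (kerProj ρ₀) (hPQ v)
    rwa [map_add, hQP, zero_add] at this
  constructor
  · refine (injective_iff_map_eq_zero _).2 fun v hv => ?_
    have hv' : ρ₀ v + kerProj ρ₀ v = 0 := hv
    have h1 : kerProj ρ₀ v = 0 := by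
      have := congrArg (kerProj ρ₀) hv'
      rwa [map_add, hQ, hQQ, zero_add, map_zero] at this
    have h2 : ρ₀ v = 0 := by rwa [h1, add_zero] at hv'
    exact (Submodule.starProjection_eq_self_iff.2
      (show v ∈ LinearMap.ker (ρ₀ : H →ₗ[ℂ] H) from h2)).symm.trans h1
  · intro w
    -- Finite rank makes the range closed, hence equal to the orthogonal complement of the kernel.
    have hclosed : (LinearMap.range (ρ₀ : H →ₗ[ℂ] H)).topologicalClosure
        = LinearMap.range (ρ₀ : H →ₗ[ℂ] H) :=
      (Submodule.closed_of_finiteDimensional _).submodule_topologicalClosure_eq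
    have hmem : suppProj ρ₀ w ∈ LinearMap.range (ρ₀ : H →ₗ[ℂ] H) := by
      have h1 : suppProj ρ₀ w ∈ (LinearMap.ker (ρ₀ : H →ₗ[ℂ] H))ᗮ :=
        Submodule.starProjection_apply_mem _ _
      have h2 := ContinuousLinearMap.orthogonal_ker ρ₀
      rw [ContinuousLinearMap.isSelfAdjoint_iff'.1 h] at h2
      rw [← hclosed]
      exact h2 ▸ h1
    obtain ⟨u, hu⟩ := hmem
    refine ⟨suppProj ρ₀ u + kerProj ρ₀ w, ?_⟩
    change ρ₀ (suppProj ρ₀ u + kerProj ρ₀ w) + kerProj ρ₀ (suppProj ρ₀ u + kerProj ρ₀ w) = w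
    rw [map_add, map_add, hP, hρQ, hQP, hQQ, add_zero, zero_add]
    exact (congrArg (· + kerProj ρ₀ w) hu).trans (hPQ w)

lemma isHS_suppProj {ι : Type*} {b : HilbertBasis ι ℂ H} {ρ₀ : H →L[ℂ] H} (h : IsSelfAdjoint ρ₀)
    (hrank : FiniteDimensional ℂ (LinearMap.range (ρ₀ : H →ₗ[ℂ] H))) (hHS : IsHS b ρ₀) :
    IsHS b (suppProj ρ₀) := by
  obtain ⟨u, hu⟩ := isUnit_add_kerProj h hrank
  have h1 : (u : H →L[ℂ] H) * suppProj ρ₀ = ρ₀ := by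
    rw [hu, add_mul, mul_suppProj, kerProj_mul_suppProj, add_zero]
  rw [← Units.inv_mul_cancel_left u (suppProj ρ₀), h1]
  exact hHS.mul_left _

/-- The compression of a small perturbation of `ρ₀` to the support of `ρ₀` has a uniformly bounded
inverse there. -/
lemma exists_compressed_inverse {ρ₀ : H →L[ℂ] H} (h : IsSelfAdjoint ρ₀)
    (hrank : FiniteDimensional ℂ (LinearMap.range (ρ₀ : H →ₗ[ℂ] H))) :
    ∃ δ : ℝ, 0 < δ ∧ ∃ c : ℝ, 0 ≤ c ∧ ∀ ν : H →L[ℂ] H, IsSelfAdjoint ν → ‖ν‖ ≤ δ →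
      ∃ g : H →L[ℂ] H, star g = g ∧ suppProj ρ₀ * g = g ∧ g * suppProj ρ₀ = g ∧
        g * (ρ₀ + ν) * suppProj ρ₀ = suppProj ρ₀ ∧ suppProj ρ₀ * (ρ₀ + ν) * g = suppProj ρ₀ ∧
        ‖g‖ ≤ c := by
  obtain ⟨u, hu⟩ := isUnit_add_kerProj h hrank
  set k := ‖((u⁻¹ : (H →L[ℂ] H)ˣ) : H →L[ℂ] H)‖ with hk
  have hk0 : 0 ≤ k := norm_nonneg _
  -- This radius gives `k * ‖t‖ ≤ 1 / 2` below, so a Neumann series applies and the inverse norm at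
  -- most doubles.
  refine ⟨1 / (2 * (k + 1)), by positivity, 2 * k, by positivity, fun ν hν hνδ => ?_⟩
  set P := suppProj ρ₀ with hP
  set Q := kerProj ρ₀ with hQ
  have hPP : P * P = P := suppProj_mul_self ρ₀
  have hPQ : P * Q = 0 := suppProj_mul_kerProj ρ₀
  have hQP : Q * P = 0 := kerProj_mul_suppProj ρ₀
  have hPs : star P = P := star_suppProj ρ₀
  have hQs : star Q = Q := star_kerProj ρ₀
  have hPρ : P * ρ₀ = ρ₀ := suppProj_mul h
  have hρP : ρ₀ * P = ρ₀ := mul_suppProj ρ₀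
  set t := P * ν * P with ht
  have hts : star t = t := by simp [ht, hPs, hν.star_eq, mul_assoc]
  have htδ : ‖t‖ ≤ 1 / (2 * (k + 1)) := by
    have hP1 : ‖P‖ ≤ 1 := norm_suppProj_le ρ₀
    calc ‖t‖ ≤ ‖P‖ * ‖ν‖ * ‖P‖ := norm_mul₃_le
      _ ≤ 1 * ‖ν‖ * 1 := by gcongr
      _ ≤ _ := by simpa using hνδ
  have hkt : k * ‖t‖ ≤ 1 / 2 := by
    calc k * ‖t‖ ≤ k * (1 / (2 * (k + 1))) := by gcongr
      _ ≤ 1 / 2 := by rw [mul_one_div, div_le_div_iff₀ (by positivity) two_pos]; linarith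
  have hunit : IsUnit (1 + ((u⁻¹ : (H →L[ℂ] H)ˣ) : H →L[ℂ] H) * t) := by
    have h1 : ‖-(((u⁻¹ : (H →L[ℂ] H)ˣ) : H →L[ℂ] H) * t)‖ < 1 := by
      rw [norm_neg]
      exact (norm_mul_le _ _).trans_lt (hkt.trans_lt (by norm_num))
    simpa using (Units.oneSub _ h1).isUnit
  obtain ⟨x, hx⟩ : IsUnit (ρ₀ + Q + t) := by
    have := u.isUnit.mul hunit
    rwa [mul_add, mul_one, Units.mul_inv_cancel_left, hu] at this
  set a : H →L[ℂ] H := ((x⁻¹ : (H →L[ℂ] H)ˣ) : H →L[ℂ] H) with ha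
  have hax : a * (ρ₀ + Q + t) = 1 := by rw [← hx, ha, Units.inv_mul]
  have hxa : (ρ₀ + Q + t) * a = 1 := by rw [← hx, ha, Units.mul_inv]
  have hPx : P * (ρ₀ + Q + t) = ρ₀ + t := by
    rw [mul_add, mul_add, hPρ, hPQ, add_zero, ht, ← mul_assoc, ← mul_assoc, hPP]
  have hxP : (ρ₀ + Q + t) * P = ρ₀ + t := by
    rw [add_mul, add_mul, hρP, hQP, add_zero, ht, mul_assoc, hPP]
  have haP : a * P = P * a := by
    calc a * P = a * (P * (ρ₀ + Q + t)) * a := by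
          rw [mul_assoc a, mul_assoc P, hxa, mul_one]
      _ = P * a := by rw [hPx, ← hxP, ← mul_assoc a, hax, one_mul]
  have hstar : star a = a := by
    have h1 : star a * (ρ₀ + Q + t) = 1 := by
      simpa [h.star_eq, hQs, hts] using congrArg star hxa
    calc star a = star a * ((ρ₀ + Q + t) * a) := by rw [hxa, mul_one]
      _ = a := by rw [← mul_assoc, h1, one_mul]
  have hPρP : P * (ρ₀ + ν) * P = ρ₀ + t := by
    rw [mul_add, add_mul, hPρ, hρP]
  have hna : ‖a‖ ≤ 2 * k := by
    have h1 : a = ((u⁻¹ : (H →L[ℂ] H)ˣ) : H →L[ℂ] H)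
        - ((u⁻¹ : (H →L[ℂ] H)ˣ) : H →L[ℂ] H) * t * a := by
      have h2 : ((u⁻¹ : (H →L[ℂ] H)ˣ) : H →L[ℂ] H) * ((u + t) * a)
          = ((u⁻¹ : (H →L[ℂ] H)ˣ) : H →L[ℂ] H) := by rw [hu, hxa, mul_one]
      rw [add_mul, mul_add, Units.inv_mul_cancel_left, ← mul_assoc] at h2
      exact eq_sub_of_add_eq h2
    have h3 : ‖a‖ ≤ k + k * ‖t‖ * ‖a‖ := by
      conv_lhs => rw [h1]
      exact (norm_sub_le _ _).trans (add_le_add_right norm_mul₃_le _)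
    nlinarith [norm_nonneg a]
  -- Adding `Q` made the compressed operator invertible on the whole space; as `a` commutes with
  -- `P`, cutting back by `P` leaves the inverse on the support.
  refine ⟨a * P, ?_, ?_, ?_, ?_, ?_, ?_⟩
  · rw [star_mul, hPs, hstar, haP]
  · rw [haP, ← mul_assoc, hPP]
  · rw [mul_assoc, hPP]
  · rw [mul_assoc, mul_assoc, ← mul_assoc P, hPρP, ← hxP, ← mul_assoc, hax, one_mul]
  · rw [haP, ← mul_assoc, hPρP, ← hPx, mul_assoc, hxa, mul_one]
  · refine (norm_mul_le _ _).trans ((mul_le_of_le_one_right (norm_nonneg _) ?_).trans hna)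
    exact norm_suppProj_le ρ₀

end CompressedInverse

/-! ### The upper bound by diagonal blocks -/

section Splitting

variable {H ι : Type*} [NormedAddCommGroup H] [InnerProductSpace ℂ H] [CompleteSpace H]
  {b : HilbertBasis ι ℂ H} {S T P Q : H →L[ℂ] H}

lemma hsInner_proj_mul (hPs : star P = P) (hPP : P * P = P) :
    hsInner b (P * S) (P * T) = hsInner b S (P * T) := by
  rw [hsInner_mul_left, hPs, ← mul_assoc, hPP]

lemma hsInner_eq_add_proj (hS : IsHS b S) (hT : IsHS b T) (hPs : star P = P) (hPP : P * P = P)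
    (hQs : star Q = Q) (hQQ : Q * Q = Q) (hPQ : P + Q = 1) :
    hsInner b S T = hsInner b (P * S) (P * T) + hsInner b (Q * S) (Q * T) := by
  rw [hsInner_proj_mul hPs hPP, hsInner_proj_mul hQs hQQ,
    ← hS.hsInner_add_right (hT.mul_left P) (hT.mul_left Q), ← add_mul, hPQ, one_mul]

lemma hsInner_le_half (hS : IsHS b S) (hT : IsHS b T) {W : H →L[ℂ] H} (hW : ‖W‖ ≤ 1) :
    hsInner b S (T * W) ≤ (hsNorm b S ^ 2 + hsNorm b T ^ 2) / 2 := by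
  have h1 := (le_abs_self _).trans (hS.abs_hsInner_le (hT.mul_right W))
  have h2 := (hT.hsNorm_mul_right_le W).trans (mul_le_of_le_one_right hsNorm_nonneg hW)
  have h3 := mul_le_mul_of_nonneg_left h2 (hsNorm_nonneg (b := b) (T := S))
  nlinarith [sq_nonneg (hsNorm b S - hsNorm b T)]

/-- The root fidelity is at most that of the diagonal blocks, the first of which is estimated by
the mean of the traces. -/
lemma rootFidelity_le_add (hS : IsHS b S) (hT : IsHS b T) (hPs : star P = P) (hPP : P * P = P)
    (hQs : star Q = Q) (hQQ : Q * Q = Q) (hPQ : P + Q = 1) :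
    rootFidelity b (S * star S) (T * star T) ≤
      (hsNorm b (P * S) ^ 2 + hsNorm b (P * T) ^ 2) / 2 +
        rootFidelity b (Q * S * star (Q * S)) (Q * T * star (Q * T)) := by
  obtain ⟨W, hW, h⟩ := exists_rootFidelity_eq_hsInner hS hT
  rw [h, hsInner_eq_add_proj hS (hT.mul_right W) hPs hPP hQs hQQ hPQ, ← mul_assoc, ← mul_assoc]
  refine add_le_add (hsInner_le_half (hS.mul_left P) (hT.mul_left P) hW) ?_
  refine (hsInner_le_rootFidelity (hS.mul_left Q) (hT.mul_left Q) W).trans ?_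
  exact mul_le_of_le_one_left (rootFidelity_nonneg (hS.mul_left Q) (hT.mul_left Q)) hW

end Splitting

/-! ### Gluing a near-optimal contraction -/

section SupportProjection

variable {H ι : Type*} [NormedAddCommGroup H] [InnerProductSpace ℂ H] [CompleteSpace H]
  {b : HilbertBasis ι ℂ H} {P Q : H →L[ℂ] H}

/-- `g` is the inverse of the compression of `y ^ 2` to the range of the projection `P`. -/
structure IsCompressedInverse (P y g : H →L[ℂ] H) : Prop where
  star_eq : star g = g
  proj_mul : P * g = g
  mul_proj : g * P = g
  mul_sq : g * (y * y) * P = P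
  sq_mul : P * (y * y) * g = P

namespace IsCompressedInverse

variable {y g y₁ y₂ g₁ g₂ : H →L[ℂ] H}

lemma mul_mul_self (h : IsCompressedInverse P y g) : g * (y * y) * g = g := by
  calc g * (y * y) * g = g * (y * y) * P * g := by rw [mul_assoc _ P, h.proj_mul]
    _ = g := by rw [h.mul_sq, h.proj_mul]

/-- With `star_proj`, this makes `y * g * y` the orthogonal projection onto the range of `y * P`. -/
lemma proj_idem (h : IsCompressedInverse P y g) :
    (y * g * y) * (y * g * y) = y * g * y := by
  conv_rhs => rw [← h.mul_mul_self]
  noncomm_ring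

lemma star_proj (h : IsCompressedInverse P y g) (hy : star y = y) :
    star (y * g * y) = y * g * y := by
  simp [hy, h.star_eq, mul_assoc]

/-- The part of the root `y` beyond the range of `y * P` differs from `Q * y` by an off-diagonal
block. -/
lemma mul_one_sub_proj (h : IsCompressedInverse P y g) (hPQ : P + Q = 1) :
    y * (1 - y * g * y) = Q * y - Q * (y * y) * P * g * y := by
  have h1 : y = P * y + Q * y := by rw [← add_mul, hPQ, one_mul]
  have h2 : (y * y) * g * y = P * y + Q * (y * y) * P * g * y := by
    rw [mul_assoc _ P, h.proj_mul]
    conv_lhs => rw [← one_mul (y * y), ← hPQ]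
    rw [add_mul, add_mul, add_mul, h.sq_mul]
  calc y * (1 - y * g * y) = y - (y * y) * g * y := by noncomm_ring
    _ = (P * y + Q * y) - (P * y + Q * (y * y) * P * g * y) := by rw [h2, ← h1]
    _ = _ := by abel

/-- `g₁` absorbs a factor `P`, so the inverse relation of the other index applies. -/
lemma mul_sq_mul (h₁ : IsCompressedInverse P y₁ g₁) (h₂ : IsCompressedInverse P y₂ g₂) :
    g₁ * (y₂ * y₂) * g₂ = g₁ := by
  rw [← h₁.mul_proj, mul_assoc, mul_assoc, ← mul_assoc P, h₂.sq_mul]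

lemma mul_sq_mul' (h₁ : IsCompressedInverse P y₁ g₁) (h₂ : IsCompressedInverse P y₂ g₂) :
    g₂ * (y₂ * y₂) * g₁ = g₁ := by
  rw [← h₁.proj_mul, ← mul_assoc, h₂.mul_sq]

/-- The resolvent identity. -/
lemma sub_eq (h₁ : IsCompressedInverse P y₁ g₁) (h₂ : IsCompressedInverse P y₂ g₂) :
    g₁ - g₂ = g₁ * (y₂ * y₂ - y₁ * y₁) * g₂ := by
  rw [mul_sub, sub_mul, h₁.mul_sq_mul h₂, h₂.mul_sq_mul' h₁]

/-- Up to an explicit error, `½ y₂ (g₁ + g₂) y₁` is a partial isometry between the ranges of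
`y₁ * P` and `y₂ * P`. -/
lemma star_mul_self_eq (h₁ : IsCompressedInverse P y₁ g₁) (h₂ : IsCompressedInverse P y₂ g₂)
    (hy₁ : star y₁ = y₁) (hy₂ : star y₂ = y₂) :
    star (y₂ * (g₁ + g₂) * y₁) * (y₂ * (g₁ + g₂) * y₁) =
      4 * (star (y₁ * g₁ * y₁) * (y₁ * g₁ * y₁)) +
        star (y₂ * (g₁ - g₂) * y₁) * (y₂ * (g₁ - g₂) * y₁) := by
  have e1 := h₁.mul_sq_mul h₂
  have e2 := h₁.mul_sq_mul' h₂
  have e3 := h₂.mul_mul_self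
  -- The only product that does not collapse, `g₁ * (y₂ * y₂) * g₁`, occurs on both sides and
  -- cancels.
  have key : (g₁ + g₂) * (y₂ * y₂) * (g₁ + g₂) =
      4 * g₁ + (g₁ - g₂) * (y₂ * y₂) * (g₁ - g₂) := by
    simp only [add_mul, mul_add, sub_mul, mul_sub, e1, e2, e3]
    noncomm_ring
  rw [h₁.star_proj hy₁, h₁.proj_idem]
  simp only [star_mul, star_add, star_sub, h₁.star_eq, h₂.star_eq, hy₁, hy₂]
  calc y₁ * ((g₁ + g₂) * y₂) * (y₂ * (g₁ + g₂) * y₁)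
      = y₁ * ((g₁ + g₂) * (y₂ * y₂) * (g₁ + g₂)) * y₁ := by noncomm_ring
    _ = _ := by rw [key]; noncomm_ring

/-- Places the range of the first glued piece inside that of `y₂ * g₂ * y₂`, orthogonal to the
second piece. -/
lemma proj_mul_mul (h₁ : IsCompressedInverse P y₁ g₁) (h₂ : IsCompressedInverse P y₂ g₂) :
    (y₂ * g₂ * y₂) * (y₂ * (g₁ + g₂) * y₁) = y₂ * (g₁ + g₂) * y₁ := by
  have : g₂ * (y₂ * y₂) * (g₁ + g₂) = g₁ + g₂ := by
    rw [mul_add, h₁.mul_sq_mul' h₂, h₂.mul_mul_self]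
  calc _ = y₂ * (g₂ * (y₂ * y₂) * (g₁ + g₂)) * y₁ := by noncomm_ring
    _ = _ := by rw [this]

end IsCompressedInverse

lemma norm_apply_sq_eq_re (A : H →L[ℂ] H) (v : H) : ‖A v‖ ^ 2 = (⟪v, (star A * A) v⟫_ℂ).re := by
  rw [mul_apply_eq_comp, inner_star_apply]
  exact (inner_self_eq_norm_sq (𝕜 := ℂ) _).symm

lemma norm_sq_eq_add_of_proj {E : H →L[ℂ] H} (hEs : star E = E) (hEE : E * E = E) (v : H) :
    ‖v‖ ^ 2 = ‖E v‖ ^ 2 + ‖(1 - E) v‖ ^ 2 := by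
  rw [norm_apply_sq_eq_re E, norm_apply_sq_eq_re (1 - E), ← Complex.add_re, ← inner_add_right,
    ← add_apply]
  have : star E * E + star (1 - E) * (1 - E) = 1 := by
    rw [star_sub, star_one, hEs, mul_sub, sub_mul, sub_mul, hEE]
    simp
  rw [this]
  exact (inner_self_eq_norm_sq (𝕜 := ℂ) v).symm

/-- A contraction glued from `½ y₂ (g₁ + g₂) y₁` and a contraction `U` between the complements
of the ranges of `y₁ * P` and `y₂ * P`, up to an explicit factor. -/
lemma norm_glue_le {y₁ y₂ g₁ g₂ U : H →L[ℂ] H} (h₁ : IsCompressedInverse P y₁ g₁)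
    (h₂ : IsCompressedInverse P y₂ g₂) (hy₁ : star y₁ = y₁) (hy₂ : star y₂ = y₂) (hU : ‖U‖ ≤ 1)
    {τ : ℝ} (hτ : ‖y₂ * (g₁ - g₂) * y₁‖ ≤ 2 * τ) :
    ‖y₂ * (g₁ + g₂) * y₁ + 2 * ((1 - y₂ * g₂ * y₂) * U * (1 - y₁ * g₁ * y₁))‖ ≤
      2 * (1 + τ ^ 2) := by
  set E₁ := y₁ * g₁ * y₁ with hE₁
  set E₂ := y₂ * g₂ * y₂ with hE₂
  set G := y₂ * (g₁ + g₂) * y₁ with hG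
  set D := y₂ * (g₁ - g₂) * y₁ with hD
  have hE₁s : star E₁ = E₁ := h₁.star_proj hy₁
  have hE₂s : star E₂ = E₂ := h₂.star_proj hy₂
  have hE₁i : E₁ * E₁ = E₁ := h₁.proj_idem
  have hE₂i : E₂ * E₂ = E₂ := h₂.proj_idem
  have hEG : E₂ * G = G := h₁.proj_mul_mul h₂
  refine ContinuousLinearMap.opNorm_le_bound _ (by positivity) fun v => ?_
  have hGv : ‖G v‖ ^ 2 = 4 * ‖E₁ v‖ ^ 2 + ‖D v‖ ^ 2 := by
    have hGG : star G * G = star E₁ * E₁ + star E₁ * E₁ + star E₁ * E₁ + star E₁ * E₁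
        + star D * D := by
      rw [h₁.star_mul_self_eq h₂ hy₁ hy₂]
      change 4 * (star E₁ * E₁) + star D * D = _
      noncomm_ring
    rw [norm_apply_sq_eq_re G, hGG, norm_apply_sq_eq_re E₁, norm_apply_sq_eq_re D]
    simp only [add_apply, inner_add_right, Complex.add_re]
    ring
  have hDv : ‖D v‖ ≤ 2 * τ * ‖v‖ := D.le_of_opNorm_le hτ v
  set w := (U ((1 - E₁) v)) with hw
  have hwv : ‖w‖ ≤ ‖(1 - E₁) v‖ :=
    (U.le_of_opNorm_le hU _).trans (one_mul _).le
  have happ : (G + 2 * ((1 - E₂) * U * (1 - E₁))) v = G v + (2 : ℂ) • (1 - E₂) w := by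
    rw [two_mul, two_smul]
    rfl
  -- The two pieces have orthogonal ranges and, up to `D`, see orthogonal parts of `v`, so squared
  -- norms add to at most `4 (1 + τ²) ‖v‖²`.
  have hpyth := norm_sq_eq_add_of_proj hE₂s hE₂i (G v + (2 : ℂ) • (1 - E₂) w)
  have hEGv : E₂ (G v) = G v := DFunLike.congr_fun hEG v
  have hEw : E₂ ((1 - E₂) w) = 0 := by
    rw [← mul_apply_eq_comp, mul_sub, mul_one, hE₂i, sub_self]; rfl
  have hFG : (1 - E₂) (G v) = 0 := by
    rw [sub_apply, hEGv]; simp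
  have hFw : (1 - E₂) ((1 - E₂) w) = (1 - E₂) w := by
    conv_lhs => rw [sub_apply, hEw]
    simp
  have hFle : ‖(1 - E₂) w‖ ^ 2 ≤ ‖w‖ ^ 2 := by
    have := norm_sq_eq_add_of_proj hE₂s hE₂i w
    nlinarith [sq_nonneg ‖E₂ w‖]
  rw [map_add, map_add, map_smul, map_smul, hEGv, hEw, hFG, hFw, smul_zero, add_zero, zero_add,
    norm_smul, hGv] at hpyth
  have hv := norm_sq_eq_add_of_proj hE₁s hE₁i v
  have h3 : ‖D v‖ ^ 2 ≤ (2 * τ * ‖v‖) ^ 2 := pow_le_pow_left₀ (norm_nonneg _) hDv 2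
  have h4 : ‖w‖ ^ 2 ≤ ‖(1 - E₁) v‖ ^ 2 := pow_le_pow_left₀ (norm_nonneg _) hwv 2
  rw [happ]
  refine le_of_sq_le_sq ?_ (by positivity)
  rw [hpyth]
  have h5 : ‖(2 : ℂ)‖ = 2 := by simp
  rw [h5]
  nlinarith [sq_nonneg (τ ^ 2 * ‖v‖), sq_nonneg (τ * ‖v‖)]

end SupportProjection

/-! ### The lower bound by diagonal blocks -/

section LowerBound

variable {H ι : Type*} [NormedAddCommGroup H] [InnerProductSpace ℂ H] [CompleteSpace H]
  {b : HilbertBasis ι ℂ H} {P Q : H →L[ℂ] H}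

/-- The overlap of the parts of the roots supported on the ranges of `y₁ * P` and `y₂ * P`. -/
lemma IsCompressedInverse.le_hsInner_mul_mul {y₁ y₂ g₁ g₂ : H →L[ℂ] H}
    (h₁ : IsCompressedInverse P y₁ g₁) (h₂ : IsCompressedInverse P y₂ g₂)
    (hy₁ : star y₁ = y₁) (hy₂ : star y₂ = y₂) (hP : IsHS b P) (hHS₁ : IsHS b y₁)
    (hHS₂ : IsHS b y₂) (hPs : star P = P) (hPP : P * P = P)
    (hQs : star Q = Q) (hQQ : Q * Q = Q) (hPQ : P + Q = 1)
    (hn₁ : hsNorm b y₁ = 1) {c ε : ℝ} (hε : 0 ≤ ε) (hg₁ : ‖g₁‖ ≤ c) (hg₂ : ‖g₂‖ ≤ c)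
    (ho : ‖Q * (y₂ * y₂) * P‖ ≤ ε) :
    hsNorm b (P * y₁) ^ 2 + hsNorm b (P * y₂) ^ 2 - 2 * (c * ε * hsNorm b (Q * y₁)) ≤
      hsInner b y₁ (y₂ * (y₂ * (g₁ + g₂) * y₁)) := by
  have hT : IsHS b (y₂ * (y₂ * (g₁ + g₂) * y₁)) := (hHS₁.mul_left _).mul_left _
  have hPT : P * (y₂ * (y₂ * (g₁ + g₂) * y₁)) = P * (y₂ * y₂) * g₁ * y₁ + P * y₁ := by
    calc _ = P * (y₂ * y₂) * g₁ * y₁ + P * (y₂ * y₂) * g₂ * y₁ := by noncomm_ring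
      _ = _ := by rw [h₂.sq_mul]
  have hQT : Q * (y₂ * (y₂ * (g₁ + g₂) * y₁)) = (Q * (y₂ * y₂) * P * (g₁ + g₂)) * y₁ := by
    rw [mul_assoc _ P, mul_add P, h₁.proj_mul, h₂.proj_mul]
    noncomm_ring
  -- Cyclicity brings `y₁ * y₁` next to `g₁`, which cancels it. Thus `g₁` contributes the second
  -- trace and `g₂` the first, which is why the sum `g₁ + g₂` is used.
  have hPpart : hsInner b (P * y₁) (P * (y₂ * y₂) * g₁ * y₁) = hsNorm b (P * y₂) ^ 2 := by
    have e1 : P * (y₂ * y₂) * g₁ * y₁ = P * ((y₂ * y₂) * g₁ * y₁) := by noncomm_ring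
    have e2 : P * ((y₂ * y₂) * g₁ * y₁) = (P * (y₂ * y₂) * g₁) * star y₁ := by
      rw [hy₁]; noncomm_ring
    have e3 : P * (y₂ * y₂) * g₁ = P * (y₂ * y₂) * star g₁ := by rw [h₁.star_eq]
    have e4 : P * (y₂ * y₂) = star P * (y₂ * star y₂) := by rw [hPs, hy₂]
    have hyy : IsHS b (y₁ * y₁) := hHS₁.mul_left _
    have hPyy : IsHS b (P * (y₂ * y₂)) := (hHS₂.mul_left _).mul_left _
    rw [e1, hsInner_proj_mul hPs hPP, e2, ← hHS₁.hsInner_mul_right (hPyy.mul_right _), e3,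
      ← hyy.hsInner_mul_right hPyy, e4, ← hsInner_mul_left, ← mul_assoc P, h₁.sq_mul,
      ← hP.hsInner_mul_right hHS₂, ← hsInner_self, hsInner_proj_mul hPs hPP, hsInner_comm]
  have hQpart : |hsInner b (Q * y₁) ((Q * (y₂ * y₂) * P * (g₁ + g₂)) * y₁)| ≤
      2 * (c * ε * hsNorm b (Q * y₁)) := by
    have hn : ‖Q * (y₂ * y₂) * P * (g₁ + g₂)‖ ≤ ε * (c + c) := by
      refine (norm_mul_le _ _).trans ?_
      gcongr
      exact (norm_add_le _ _).trans (add_le_add hg₁ hg₂)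
    refine ((hHS₁.mul_left Q).abs_hsInner_le (hHS₁.mul_left _)).trans ?_
    have h3 := (hHS₁.hsNorm_mul_left_le (Q * (y₂ * y₂) * P * (g₁ + g₂))).trans
      (mul_le_mul_of_nonneg_right hn hsNorm_nonneg)
    rw [hn₁, mul_one] at h3
    have := mul_le_mul_of_nonneg_left h3 (hsNorm_nonneg (b := b) (T := Q * y₁))
    linarith
  rw [hsInner_eq_add_proj hHS₁ hT hPs hPP hQs hQQ hPQ, hPT, hQT,
    (hHS₁.mul_left P).hsInner_add_right (hHS₁.mul_left _) (hHS₁.mul_left P), hPpart,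
    hsInner_self]
  have := (abs_le.1 hQpart).1
  linarith

/-- The overlap of the parts of the roots beyond the ranges of `y₁ * P` and `y₂ * P`. -/
lemma IsCompressedInverse.le_hsInner_compl {y₁ y₂ g₁ g₂ U : H →L[ℂ] H}
    (h₁ : IsCompressedInverse P y₁ g₁) (h₂ : IsCompressedInverse P y₂ g₂)
    (hy₁ : star y₁ = y₁) (hHS₁ : IsHS b y₁)
    (hHS₂ : IsHS b y₂) (hPQ : P + Q = 1) (hU : ‖U‖ ≤ 1)
    (hn₁ : hsNorm b y₁ = 1) (hn₂ : hsNorm b y₂ = 1) {c ε η : ℝ} (hε : 0 ≤ ε)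
    (hg₁ : ‖g₁‖ ≤ c) (hg₂ : ‖g₂‖ ≤ c)
    (ho₁ : ‖Q * (y₁ * y₁) * P‖ ≤ ε) (ho₂ : ‖Q * (y₂ * y₂) * P‖ ≤ ε)
    (hη₁ : hsNorm b (Q * y₁) ≤ η) (hη₂ : hsNorm b (Q * y₂) ≤ η) :
    hsInner b (Q * y₁) (Q * y₂ * U) - (2 * (c * ε * η) + (c * ε) ^ 2) ≤
      hsInner b y₁ (y₂ * ((1 - y₂ * g₂ * y₂) * U * (1 - y₁ * g₁ * y₁))) := by
  have hc : 0 ≤ c := (norm_nonneg _).trans hg₁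
  have hη : 0 ≤ η := hsNorm_nonneg.trans hη₁
  set R₁ := Q * (y₁ * y₁) * P * g₁ * y₁ with hR₁
  set R₂ := Q * (y₂ * y₂) * P * g₂ * y₂ with hR₂
  have hR₁HS : IsHS b R₁ := hHS₁.mul_left _
  have hR₂HS : IsHS b R₂ := hHS₂.mul_left _
  have hQ₁ : IsHS b (Q * y₁) := hHS₁.mul_left _
  have hQ₂ : IsHS b (Q * y₂) := hHS₂.mul_left _
  have bound : ∀ {y g : H →L[ℂ] H}, IsHS b y → hsNorm b y = 1 → ‖g‖ ≤ c →
      ‖Q * (y * y) * P‖ ≤ ε → hsNorm b (Q * (y * y) * P * g * y) ≤ c * ε := by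
    intro y g hy hn hg ho
    refine (hy.hsNorm_mul_left_le _).trans ?_
    rw [hn, mul_one, mul_comm c]
    refine (norm_mul_le _ _).trans ?_
    gcongr
  have hR₁n : hsNorm b R₁ ≤ c * ε := bound hHS₁ hn₁ hg₁ ho₁
  have hR₂n : hsNorm b R₂ ≤ c * ε := bound hHS₂ hn₂ hg₂ ho₂
  have mulU : ∀ {T : H →L[ℂ] H}, IsHS b T → hsNorm b (T * U) ≤ hsNorm b T := fun hT =>
    (hT.hsNorm_mul_right_le U).trans (mul_le_of_le_one_right hsNorm_nonneg hU)
  -- One complementary projection goes to each root, turning `yᵢ` into `Q * yᵢ - Rᵢ` with `Rᵢ` of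
  -- norm at most `c * ε`; the expansion has one main term and three errors.
  have e1 : y₂ * ((1 - y₂ * g₂ * y₂) * U * (1 - y₁ * g₁ * y₁)) =
      (Q * y₂ * U - R₂ * U) * star (1 - y₁ * g₁ * y₁) := by
    rw [← sub_mul, ← h₂.mul_one_sub_proj hPQ, star_sub, star_one, h₁.star_proj hy₁]
    noncomm_ring
  have hx₁ : y₁ * (1 - y₁ * g₁ * y₁) = Q * y₁ - R₁ := h₁.mul_one_sub_proj hPQ
  have hA := hQ₂.mul_right U
  have hB := hR₂HS.mul_right U
  rw [e1, ← hHS₁.hsInner_mul_right (hA.sub hB), hx₁, (hA.sub hB).hsInner_sub_left hQ₁ hR₁HS,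
    hQ₁.hsInner_sub_right hA hB, hR₁HS.hsInner_sub_right hA hB]
  have prod : ∀ {S T : H →L[ℂ] H} {s t : ℝ}, IsHS b S → IsHS b T → hsNorm b S ≤ s →
      hsNorm b T ≤ t → 0 ≤ s → |hsInner b S T| ≤ s * t := fun hS hT hs ht hs0 =>
    (hS.abs_hsInner_le hT).trans (mul_le_mul hs ht hsNorm_nonneg hs0)
  have t1 := (abs_le.1 (prod hQ₁ hB hη₁ ((mulU hR₂HS).trans hR₂n) hη)).2
  have t2 := (abs_le.1 (prod hR₁HS hA hR₁n ((mulU hQ₂).trans hη₂) (by positivity))).2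
  have t3 := (abs_le.1 (prod hR₁HS hB hR₁n ((mulU hR₂HS).trans hR₂n) (by positivity))).1
  linarith

/-- The root fidelity of two states is at least that of the diagonal blocks up to a small error,
where the root fidelity of the first blocks is the mean of the traces up to such an error. -/
lemma IsCompressedInverse.le_rootFidelity {y₁ y₂ g₁ g₂ : H →L[ℂ] H}
    (h₁ : IsCompressedInverse P y₁ g₁) (h₂ : IsCompressedInverse P y₂ g₂)
    (hy₁ : star y₁ = y₁) (hy₂ : star y₂ = y₂) (hP : IsHS b P) (hHS₁ : IsHS b y₁)
    (hHS₂ : IsHS b y₂) (hPs : star P = P) (hPP : P * P = P)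
    (hQs : star Q = Q) (hQQ : Q * Q = Q) (hPQ : P + Q = 1)
    (hn₁ : hsNorm b y₁ = 1) (hn₂ : hsNorm b y₂ = 1) {c ε η : ℝ} (hε : 0 ≤ ε)
    (hg₁ : ‖g₁‖ ≤ c) (hg₂ : ‖g₂‖ ≤ c) (hd : ‖y₂ * y₂ - y₁ * y₁‖ ≤ 2 * ε)
    (ho₁ : ‖Q * (y₁ * y₁) * P‖ ≤ ε) (ho₂ : ‖Q * (y₂ * y₂) * P‖ ≤ ε)
    (hη₁ : hsNorm b (Q * y₁) ≤ η) (hη₂ : hsNorm b (Q * y₂) ≤ η) :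
    (hsNorm b (P * y₁) ^ 2 + hsNorm b (P * y₂) ^ 2) / 2 +
        rootFidelity b (Q * y₁ * star (Q * y₁)) (Q * y₂ * star (Q * y₂)) -
        (3 * (c * ε * η) + (c * ε) ^ 2 + (c ^ 2 * ε) ^ 2) ≤
      rootFidelity b (y₁ * star y₁) (y₂ * star y₂) := by
  have hc : 0 ≤ c := (norm_nonneg _).trans hg₁
  obtain ⟨U, hU, hUF⟩ := exists_rootFidelity_eq_hsInner (hHS₁.mul_left Q) (hHS₂.mul_left Q)
  have k1 := h₁.le_hsInner_mul_mul h₂ hy₁ hy₂ hP hHS₁ hHS₂ hPs hPP hQs hQQ hPQ hn₁ hε hg₁ hg₂ ho₂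
  have k2 := h₁.le_hsInner_compl h₂ hy₁ hHS₁ hHS₂ hPQ hU hn₁ hn₂ hε hg₁ hg₂ ho₁ ho₂ hη₁ hη₂
  have hτ : ‖y₂ * (g₁ - g₂) * y₁‖ ≤ 2 * (c ^ 2 * ε) := by
    have hy₁n : ‖y₁‖ ≤ 1 := hn₁ ▸ hHS₁.norm_le_hsNorm
    have hy₂n : ‖y₂‖ ≤ 1 := hn₂ ▸ hHS₂.norm_le_hsNorm
    calc ‖y₂ * (g₁ - g₂) * y₁‖ ≤ ‖y₂‖ * ‖g₁ - g₂‖ * ‖y₁‖ := norm_mul₃_le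
      _ ≤ 1 * (c * (2 * ε) * c) * 1 := by
          gcongr
          rw [h₁.sub_eq h₂]
          exact norm_mul₃_le.trans (by gcongr)
      _ = 2 * (c ^ 2 * ε) := by ring
  have k3 := norm_glue_le h₁ h₂ hy₁ hy₂ hU hτ
  have hF0 := rootFidelity_nonneg hHS₁ hHS₂
  have hF1 := rootFidelity_le hHS₁ hHS₂
  rw [hn₁, hn₂, mul_one] at hF1
  have k4 := (hsInner_le_rootFidelity hHS₁ hHS₂ _).trans (mul_le_mul_of_nonneg_right k3 hF0)
  have e : ∀ G X : H →L[ℂ] H, y₂ * (G + 2 * X) = y₂ * G + 2 * (y₂ * X) := fun G X => by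
    noncomm_ring
  rw [e, hHS₁.hsInner_add_right ((hHS₁.mul_left _).mul_left _) ((hHS₂.mul_right _).mul_left _),
    hsInner_two_mul_right] at k4
  rw [hUF]
  have k5 : c * ε * hsNorm b (Q * y₁) ≤ c * ε * η := by gcongr
  -- As the root fidelity is at most one, the excess norm of the glued operator becomes an additive
  -- error.
  have k6 : (c ^ 2 * ε) ^ 2 * rootFidelity b (y₁ * star y₁) (y₂ * star y₂) ≤ (c ^ 2 * ε) ^ 2 :=
    mul_le_of_le_one_right (sq_nonneg _) hF1
  linarith

end LowerBound

/-! ### Traces and blocks of the perturbed states -/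

section Perturbation

variable {H ι : Type*} [NormedAddCommGroup H] [InnerProductSpace ℂ H] [CompleteSpace H]
  {b : HilbertBasis ι ℂ H} {ρ ρ₀ ν y : H →L[ℂ] H}

/-- The square root of a state is a Hilbert-Schmidt operator of norm one. -/
lemma IsQuantumState.isHS_sqrt (h : IsQuantumState b ρ) :
    IsHS b (CFC.sqrt ρ) ∧ hsNorm b (CFC.sqrt ρ) = 1 := by
  have h1 : HasSum (fun i => ‖CFC.sqrt ρ (b i)‖ ^ 2) 1 :=
    (Complex.hasSum_re h.hasSum_trace).congr_fun fun i =>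
      (re_inner_apply_eq_norm_sqrt_sq h.nonneg (b i)).symm
  exact ⟨h1.summable, by rw [hsNorm, h1.tsum_eq, Real.sqrt_one]⟩

lemma IsQuantumState.isHS (h : IsQuantumState b ρ) : IsHS b ρ := by
  rw [← CFC.sqrt_mul_sqrt_self ρ h.nonneg]
  exact h.isHS_sqrt.1.mul_left _

lemma IsStatePerturbation.isQuantumState (h₀ : IsQuantumState b ρ₀)
    (h : IsStatePerturbation b ρ₀ ν) : IsQuantumState b (ρ₀ + ν) where
  nonneg := h.nonneg
  hasSum_trace := by
    have := h₀.hasSum_trace.add h.hasSum_trace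
    rw [add_zero] at this
    exact this.congr_fun fun i => by rw [add_apply, inner_add_right]

lemma IsStatePerturbation.isHS (h₀ : IsQuantumState b ρ₀) (h : IsStatePerturbation b ρ₀ ν) :
    IsHS b ν := by
  rw [← add_sub_cancel_left ρ₀ ν]
  exact (h.isQuantumState h₀).isHS.sub h₀.isHS

/-- The trace of the block of a perturbation on the support, in terms of a root `y` of the
perturbed state. -/
lemma exists_hasSum_blockB (h₀ : IsQuantumState b ρ₀) (hy : star y = y) (hyy : y * y = ρ₀ + ν)
    (hHS : IsHS b y) :
    ∃ t : ℂ, HasSum (fun i => ⟪b i, blockB ρ₀ ν (b i)⟫_ℂ) t ∧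
      t.re = hsNorm b (suppProj ρ₀ * y) ^ 2 - 1 := by
  have hsa : IsSelfAdjoint ρ₀ := .of_nonneg h₀.nonneg
  have hyP : IsHS b (y * suppProj ρ₀) := hHS.mul_right _
  have h1 : HasSum (fun i => ⟪(y * suppProj ρ₀) (b i), (y * suppProj ρ₀) (b i)⟫_ℂ) _ :=
    lp.hasSum_inner (𝕜 := ℂ) hyP.toLp hyP.toLp
  refine ⟨_, (h1.sub h₀.hasSum_trace).congr_fun fun i => ?_, ?_⟩
  · have h2 : blockB ρ₀ ν = star (y * suppProj ρ₀) * (y * suppProj ρ₀) - ρ₀ := by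
      have h3 : star (y * suppProj ρ₀) * (y * suppProj ρ₀) =
          suppProj ρ₀ * (y * y) * suppProj ρ₀ := by
        rw [star_mul, star_suppProj, hy]; noncomm_ring
      rw [h3, hyy, mul_add, add_mul, suppProj_mul hsa, mul_suppProj, add_sub_cancel_left, blockB]
    rw [h2, sub_apply, inner_sub_right, mul_apply_eq_comp, inner_star_apply]
  · rw [Complex.sub_re, ← hyP.hsInner_eq hyP, hsInner_self, Complex.one_re,
      ← hyP.hsNorm_star, star_mul, star_suppProj, hy]

/-- The left side is `-Re Tr ν_B`, that is, minus the pairing of the projection `P` with `ν P`;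
Cauchy-Schwarz bounds it because `P` is Hilbert-Schmidt. -/
lemma one_sub_le_of_perturbation (h₀ : IsQuantumState b ρ₀) (hP : IsHS b (suppProj ρ₀))
    (hν : IsHS b ν) (hy : star y = y) (hyy : y * y = ρ₀ + ν) (hHS : IsHS b y) :
    1 - hsNorm b (suppProj ρ₀ * y) ^ 2 ≤ hsNorm b (suppProj ρ₀) * hsNorm b ν := by
  obtain ⟨t, ht, htre⟩ := exists_hasSum_blockB h₀ hy hyy hHS
  have h1 : hsInner b (suppProj ρ₀) (ν * suppProj ρ₀) = t.re := by
    rw [← (Complex.hasSum_re ht).tsum_eq]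
    refine tsum_congr fun i => ?_
    have h2 : blockB ρ₀ ν = star (suppProj ρ₀) * (ν * suppProj ρ₀) := by
      rw [blockB, star_suppProj, mul_assoc]
    rw [h2]
    exact congrArg Complex.re
      (inner_star_apply (suppProj ρ₀) (b i) ((ν * suppProj ρ₀) (b i))).symm
  have h3 := (hP.abs_hsInner_le (hν.mul_right (suppProj ρ₀)))
  have h4 := (hν.hsNorm_mul_right_le (suppProj ρ₀)).trans
    (mul_le_of_le_one_right hsNorm_nonneg (norm_suppProj_le ρ₀))
  have h5 := mul_le_mul_of_nonneg_left h4 (hsNorm_nonneg (b := b) (T := suppProj ρ₀))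
  have h6 := (abs_le.1 h3).1
  rw [h1, htre] at h6
  linarith

/-- Exhibits a factor of the D block to which Uhlmann's theorem applies. -/
lemma blockD_eq (h₀ : IsQuantumState b ρ₀) (hy : star y = y) (hyy : y * y = ρ₀ + ν) :
    blockD ρ₀ ν = kerProj ρ₀ * y * star (kerProj ρ₀ * y) := by
  have h1 : kerProj ρ₀ * y * star (kerProj ρ₀ * y) = kerProj ρ₀ * (y * y) * kerProj ρ₀ := by
    rw [star_mul, star_kerProj, hy]; noncomm_ring
  rw [h1, hyy, mul_add, kerProj_mul (.of_nonneg h₀.nonneg), zero_add, blockD]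

lemma norm_offDiag_le (h₀ : IsQuantumState b ρ₀) (hyy : y * y = ρ₀ + ν) (hν : IsHS b ν) :
    ‖kerProj ρ₀ * (y * y) * suppProj ρ₀‖ ≤ hsNorm b ν := by
  rw [hyy, mul_add, kerProj_mul (.of_nonneg h₀.nonneg), zero_add]
  calc _ ≤ ‖kerProj ρ₀‖ * ‖ν‖ * ‖suppProj ρ₀‖ := norm_mul₃_le
    _ ≤ 1 * hsNorm b ν * 1 := by
        gcongr
        · exact mul_nonneg zero_le_one hsNorm_nonneg
        · exact norm_kerProj_le ρ₀
        · exact hν.norm_le_hsNorm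
        · exact norm_suppProj_le ρ₀
    _ = _ := by ring

/-- Squaring a two-sided estimate of the root fidelity. -/
lemma abs_sq_sub_le {f α d m R s : ℝ} (hs : 0 ≤ s) (hs1 : s ≤ 1) (hR : 0 ≤ R)
    (hα : α ≤ 1) (hα' : 1 - m * s ^ 2 ≤ α) (hd : 0 ≤ d) (hd' : d ≤ m * s ^ 2) (hf : f ≤ α + d)
    (hf' : α + d - R * s ^ 3 ≤ f) :
    |f ^ 2 - (2 * α - 1 + 2 * d)| ≤ (2 * R + (m + R) ^ 2) * s ^ 3 := by
  have h2 : s ^ 3 ≤ s ^ 2 := pow_le_pow_of_le_one hs hs1 (by norm_num)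
  have h4 : s ^ 4 ≤ s ^ 3 := pow_le_pow_of_le_one hs hs1 (by norm_num)
  have hu : |f - 1| ≤ (m + R) * s ^ 2 := by
    have := mul_le_mul_of_nonneg_left h2 hR
    exact abs_le.2 ⟨by linarith, by nlinarith [sq_nonneg s]⟩
  have hsq : (f - 1) ^ 2 ≤ (m + R) ^ 2 * s ^ 3 := by
    calc (f - 1) ^ 2 = |f - 1| ^ 2 := (sq_abs _).symm
      _ ≤ ((m + R) * s ^ 2) ^ 2 := pow_le_pow_left₀ (abs_nonneg _) hu 2
      _ = (m + R) ^ 2 * s ^ 4 := by ring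
      _ ≤ _ := by gcongr
  -- Linearization at `f = 1`: since `f - 1 = O(s²)`, the quadratic term is `O(s⁴)`.
  have e : f ^ 2 - (2 * α - 1 + 2 * d) = (f - 1) ^ 2 + 2 * (f - (α + d)) := by ring
  have h3 : 0 ≤ s ^ 3 := by positivity
  rw [e]
  refine abs_le.2 ⟨?_, ?_⟩
  · nlinarith [sq_nonneg (f - 1), mul_nonneg (sq_nonneg (m + R)) h3]
  · nlinarith [mul_nonneg hR h3]

end Perturbation

/-! ### The expansion of the fidelity -/

theorem theorem11 {H : Type*} [NormedAddCommGroup H] [InnerProductSpace ℂ H] [CompleteSpace H]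
    {ι : Type*} (b : HilbertBasis ι ℂ H) (ρ₀ : H →L[ℂ] H) (hρ₀ : IsQuantumState b ρ₀)
    (hrank : FiniteDimensional ℂ (LinearMap.range (ρ₀ : H →ₗ[ℂ] H))) (K : ℝ) :
    ∃ δ : ℝ, 0 < δ ∧ ∃ C : ℝ, ∀ ν₁ ν₂ : H →L[ℂ] H,
      IsStatePerturbation b ρ₀ ν₁ → IsStatePerturbation b ρ₀ ν₂ →
      hsNorm b ν₁ ≤ δ → hsNorm b ν₂ ≤ δ →
      hsNorm b ν₁ ^ 2 ≤ K * hsNorm b ν₁ * hsNorm b (blockD ρ₀ ν₁) →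
      hsNorm b ν₂ ^ 2 ≤ K * hsNorm b ν₂ * hsNorm b (blockD ρ₀ ν₂) →
      |fidelity b (ρ₀ + ν₁) (ρ₀ + ν₂) -
          (1 + (opTrace b (blockB ρ₀ ν₁ + blockB ρ₀ ν₂)).re +
            2 * rootFidelity b (blockD ρ₀ ν₁) (blockD ρ₀ ν₂))| ≤
        C * max (hsNorm b ν₁) (hsNorm b ν₂) ^ (3 / 2 : ℝ) := by
  have hsa : IsSelfAdjoint ρ₀ := .of_nonneg hρ₀.nonneg
  have hP : IsHS b (suppProj ρ₀) := isHS_suppProj hsa hrank hρ₀.isHS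
  obtain ⟨δ, hδ, c, hc, hg⟩ := exists_compressed_inverse hsa hrank
  set m := hsNorm b (suppProj ρ₀) with hm
  have hm0 : 0 ≤ m := hsNorm_nonneg
  -- The error of the lower bound at `ε = s²`, `η = √m * s`, with `s⁴` estimated by `s³`.
  set R := 3 * (c * √m) + c ^ 2 + (c ^ 2) ^ 2 with hR
  refine ⟨min δ 1, lt_min hδ one_pos, 2 * R + (m + R) ^ 2, ?_⟩
  intro ν₁ ν₂ hν₁ hν₂ hδ₁ hδ₂ _ _
  set ε := max (hsNorm b ν₁) (hsNorm b ν₂) with hε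
  have hε0 : 0 ≤ ε := hsNorm_nonneg.trans (le_max_left _ _)
  have hε1 : ε ≤ 1 := max_le (hδ₁.trans (min_le_right _ _)) (hδ₂.trans (min_le_right _ _))
  set s := √ε with hs
  have hs0 : 0 ≤ s := Real.sqrt_nonneg _
  have hss : s ^ 2 = ε := Real.sq_sqrt hε0
  have hs1 : s ≤ 1 := Real.sqrt_le_one.2 hε1
  have hpow : ε ^ (3 / 2 : ℝ) = s ^ 3 := by
    rw [hs, Real.sqrt_eq_rpow, ← Real.rpow_natCast, ← Real.rpow_mul hε0]
    norm_num
  have hQQ : kerProj ρ₀ * kerProj ρ₀ = kerProj ρ₀ := Submodule.isIdempotentElem_starProjection _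
  have root : ∀ {ν : H →L[ℂ] H}, IsStatePerturbation b ρ₀ ν → hsNorm b ν ≤ ε → hsNorm b ν ≤ δ →
      ∃ y g t, star y = y ∧ y * y = ρ₀ + ν ∧ IsHS b y ∧ hsNorm b y = 1 ∧
        IsCompressedInverse (suppProj ρ₀) y g ∧ ‖g‖ ≤ c ∧
        ‖kerProj ρ₀ * (y * y) * suppProj ρ₀‖ ≤ ε ∧
        blockD ρ₀ ν = kerProj ρ₀ * y * star (kerProj ρ₀ * y) ∧
        hsNorm b (kerProj ρ₀ * y) ≤ √m * s ∧
        HasSum (fun i => ⟪b i, blockB ρ₀ ν (b i)⟫_ℂ) t ∧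
        t.re = hsNorm b (suppProj ρ₀ * y) ^ 2 - 1 ∧
        hsNorm b (suppProj ρ₀ * y) ^ 2 ≤ 1 ∧ 1 - m * ε ≤ hsNorm b (suppProj ρ₀ * y) ^ 2 := by
    intro ν hν hνε hνδ
    have hst := hν.isQuantumState hρ₀
    obtain ⟨hHS, hn⟩ := hst.isHS_sqrt
    have hνHS := hν.isHS hρ₀
    have hy := star_sqrt (ρ₀ + ν)
    have hyy : CFC.sqrt (ρ₀ + ν) * CFC.sqrt (ρ₀ + ν) = ρ₀ + ν :=
      CFC.sqrt_mul_sqrt_self _ hst.nonneg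
    set y := CFC.sqrt (ρ₀ + ν)
    obtain ⟨g, g1, g2, g3, g4, g5, g6⟩ := hg ν hν.isSelfAdjoint (hνHS.norm_le_hsNorm.trans hνδ)
    obtain ⟨t, ht, htre⟩ := exists_hasSum_blockB hρ₀ hy hyy hHS
    have hsplit := hsInner_eq_add_proj hHS hHS (star_suppProj ρ₀) (suppProj_mul_self ρ₀)
      (star_kerProj ρ₀) hQQ (suppProj_add_kerProj ρ₀)
    rw [hsInner_self, hsInner_self, hsInner_self, hn] at hsplit
    have hlow := one_sub_le_of_perturbation hρ₀ hP hνHS hy hyy hHS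
    have hlow' : m * hsNorm b ν ≤ m * ε := mul_le_mul_of_nonneg_left hνε hm0
    refine ⟨y, g, t, hy, hyy, hHS, hn, ⟨g1, g2, g3, hyy ▸ g4, hyy ▸ g5⟩, g6,
      (norm_offDiag_le hρ₀ hyy hνHS).trans hνε, blockD_eq hρ₀ hy hyy, ?_, ht, htre, ?_, ?_⟩
    -- `‖Q y‖² = 1 - ‖P y‖² ≤ m * ε`: the weight outside the support is of first order.
    · rw [hs, ← Real.sqrt_mul hm0]
      refine Real.le_sqrt_of_sq_le ?_
      linarith
    · nlinarith [sq_nonneg (hsNorm b (kerProj ρ₀ * y))]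
    · linarith
  obtain ⟨y₁, g₁, t₁, hy₁, hyy₁, hHS₁, hn₁, hg₁, hgc₁, ho₁, hD₁, hη₁, ht₁, htr₁, hu₁, hl₁⟩ :=
    root hν₁ (le_max_left _ _) (hδ₁.trans (min_le_left _ _))
  obtain ⟨y₂, g₂, t₂, hy₂, hyy₂, hHS₂, hn₂, hg₂, hgc₂, ho₂, hD₂, hη₂, ht₂, htr₂, hu₂, hl₂⟩ :=
    root hν₂ (le_max_right _ _) (hδ₂.trans (min_le_left _ _))
  have hdiff : ‖y₂ * y₂ - y₁ * y₁‖ ≤ 2 * ε := by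
    rw [hyy₁, hyy₂, add_sub_add_left_eq_sub]
    have h1 := (hν₁.isHS hρ₀).norm_le_hsNorm.trans (le_max_left _ (hsNorm b ν₂))
    have h2 := (hν₂.isHS hρ₀).norm_le_hsNorm.trans (le_max_right (hsNorm b ν₁) _)
    exact (norm_sub_le _ _).trans (by linarith)
  have hlower := hg₁.le_rootFidelity hg₂ hy₁ hy₂ hP hHS₁ hHS₂ (star_suppProj ρ₀)
    (suppProj_mul_self ρ₀) (star_kerProj ρ₀) hQQ (suppProj_add_kerProj ρ₀) hn₁ hn₂ hε0 hgc₁ hgc₂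
    hdiff ho₁ ho₂ hη₁ hη₂
  have hupper := rootFidelity_le_add hHS₁ hHS₂ (star_suppProj ρ₀) (suppProj_mul_self ρ₀)
    (star_kerProj ρ₀) hQQ (suppProj_add_kerProj ρ₀)
  have hd0 := rootFidelity_nonneg (hHS₁.mul_left (kerProj ρ₀)) (hHS₂.mul_left (kerProj ρ₀))
  have hd1 := rootFidelity_le (hHS₁.mul_left (kerProj ρ₀)) (hHS₂.mul_left (kerProj ρ₀))
  have htrace : (opTrace b (blockB ρ₀ ν₁ + blockB ρ₀ ν₂)).re = t₁.re + t₂.re := by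
    rw [← Complex.add_re, ← (ht₁.add ht₂).tsum_eq]
    refine congrArg Complex.re (tsum_congr fun i => ?_)
    rw [add_apply, inner_add_right]
  rw [← hD₁, ← hD₂, hy₁, hy₂, hyy₁, hyy₂] at hlower hupper
  rw [← hD₁, ← hD₂] at hd0 hd1
  have hd2 : rootFidelity b (blockD ρ₀ ν₁) (blockD ρ₀ ν₂) ≤ m * s ^ 2 := by
    refine hd1.trans ((mul_le_mul hη₁ hη₂ hsNorm_nonneg (by positivity)).trans_eq ?_)
    linear_combination s ^ 2 * Real.mul_self_sqrt hm0
  have hrem : 3 * (c * ε * (√m * s)) + (c * ε) ^ 2 + (c ^ 2 * ε) ^ 2 ≤ R * s ^ 3 := by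
    have h4 : s ^ 4 ≤ s ^ 3 := pow_le_pow_of_le_one hs0 hs1 (by norm_num)
    have h5 := mul_le_mul_of_nonneg_left h4 (show 0 ≤ c ^ 2 + (c ^ 2) ^ 2 by positivity)
    rw [← hss, hR]
    linarith
  rw [htrace, htr₁, htr₂, hpow, fidelity]
  rw [← hss] at hl₁ hl₂
  -- With `α` the mean of the support traces, `2 * α - 1` is one plus the traces of both B blocks.
  have := abs_sq_sub_le hs0 hs1 (by positivity : 0 ≤ R)
    (α := (hsNorm b (suppProj ρ₀ * y₁) ^ 2 + hsNorm b (suppProj ρ₀ * y₂) ^ 2) / 2)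
    (by linarith) (by linarith) hd0 hd2 hupper (by linarith)
  refine le_trans (le_of_eq ?_) this
  congr 1
  ring
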